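/- Let $\mathcal H$ be a finite-dimensional complex Hilbert space with inner product $\langle\cdot|\cdot\rangle$ (antilinear in the first argument), and let $\mathcal P=\mathbb{CP}(\mathcal H)$ be its projective space with canonical projection $\pi\colon\mathcal H\setminus\{0\}\to\mathcal P$. Equip $\mathcal P$ with its complex structure $J$, with the Fubini--Study metric $g$ determined by $$(\pi^*g)_\psi(u,v)=\mathrm{Re}\Big(\frac{\langle u|v\rangle}{\langle\psi|\psi\rangle}-\frac{\langle u|\psi\rangle\langle\psi|v\rangle}{\langle\psi|\psi\rangle^2}\Big),$$ and with the symplectic form $\omega(X,Y)=g(X,JY)$. Let $\mathfrak{su}(\mathcal H)$ be the real Lie algebra of traceless skew-adjoint operators and $\mathfrak{sl}(\mathcal H)$ the Lie algebra of traceless operators, with $[A,B]=AB-BA$. For $A\in\mathfrak{su}(\mathcal H)$ let $X_A(p)=\frac{d}{dt}\big|_{t=0}e^{tA}\cdot p$ be the vector field on $\mathcal P$ generating the natural action of $SU(\mathcal H)$, and let $Y_A=J(X_A)$. Then: 1. $\mathcal P$ is compact. For every $A\in\mathfrak{su}(\mathcal H)$ the curves $t\mapsto e^{tA}\cdot p$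 are integral curves of $X_A$. The vector fields $X_A$ and $Y_A$ are smooth and are, respectively, the Hamiltonian and the gradient vector field of the smooth function $f_A([\psi])=\tfrac12\langle\psi|iA\psi\rangle/\langle\psi|\psi\rangle$, that is, $df_A=\omega(\cdot,X_A)=g(\cdot,Y_A)$. 2. For all $A,B\in\mathfrak{su}(\mathcal H)$ the Lie brackets of vector fields satisfy $$[X_A,X_B]=-X_{[A,B]},\qquad [X_A,Y_B]=-Y_{[A,B]},\qquad [Y_A,Y_B]=X_{[A,B]}.$$ 3. Consequently the vector fields $X_A,Y_A$ realize the Lie algebra $\mathfrak{sl}(\mathcal H)$: there is an injective real-linear map $\zeta$ from $\mathfrak{sl}(\mathcal H)$ to the vector fields on $\mathcal P$ with $\zeta(A)=X_A$ and $\zeta(iA)=Y_A$ for $A\in\mathfrak{su}(\mathcal H)$, and $[\zeta(S),\zeta(T)]=-\zeta([S,T])$ for all $S,T\in\mathfrak{sl}(\mathcal H)$. 4. This realization integrates to a smooth left action $\Phi$ of $SL(\mathcal H)$ on $\mathcal P$: for all $S\in\mathfrak{sl}(\mathcal H)$ and $p\in\mathcal P$ the curve $t\mapsto\Phi(e^{tS})(p)$,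 $t\in\mathbb R$, is an integral curve of $\zeta(S)$. In particular the fields $\zeta(S)$ are complete. -/

import Mathlib

open scoped LinearAlgebra.Projectivization Manifold ContDiff Topology InnerProductSpace

attribute [local instance] LieRing.ofAssociativeRing

namespace QuantumGeometry

noncomputable section

set_option linter.unusedSectionVars false

variable {H : Type*} [NormedAddCommGroup H] [InnerProductSpace ℂ H]

/-! ### The manifold structure of complex projective space -/

/-- The projective space carries the quotient topology of the space of nonzero vectors. -/
instance instTopologicalSpaceProj : TopologicalSpace (ℙ ℂ H) :=
  TopologicalSpace.coinduced (Projectivization.mk' ℂ (V := H)) inferInstance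

theorem isOpenQuotientMap_mk' :
    IsOpenQuotientMap (Projectivization.mk' ℂ (V := H)) := by
  have hq : Topology.IsQuotientMap (Projectivization.mk' ℂ (V := H)) :=
    ⟨⟨rfl⟩, fun p => ⟨⟨p.rep, p.rep_nonzero⟩, by simp⟩⟩
  refine ⟨hq.surjective, hq.continuous, fun U hU => ?_⟩
  rw [← hq.isOpen_preimage]
  have : Projectivization.mk' ℂ ⁻¹' (Projectivization.mk' ℂ '' U) =
      ⋃ a : ℂˣ, (fun v : {v : H // v ≠ 0} =>
        (⟨a • (v : H), (smul_ne_zero_iff_ne a).2 v.2⟩ : {v : H // v ≠ 0})) ⁻¹' U := by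
    ext v
    simp only [Set.mem_preimage, Set.mem_image, Set.mem_iUnion]
    constructor
    · rintro ⟨w, hw, h⟩
      obtain ⟨a, ha⟩ := (Projectivization.mk_eq_mk_iff ℂ _ _ w.2 v.2).1 h
      refine ⟨a, ?_⟩
      convert hw
    · rintro ⟨a, ha⟩
      exact ⟨_, ha, (Projectivization.mk_eq_mk_iff ℂ _ _ _ v.2).2 ⟨a, rfl⟩⟩
  rw [this]
  refine isOpen_iUnion fun a => hU.preimage ?_
  exact Continuous.subtype_mk (continuous_subtype_val.const_smul a) _

instance instT2SpaceProj : T2Space (ℙ ℂ H) := by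
  rw [t2Space_iff_of_isOpenQuotientMap isOpenQuotientMap_mk']
  have : {q : {v : H // v ≠ 0} × {v : H // v ≠ 0} |
      Projectivization.mk' ℂ q.1 = Projectivization.mk' ℂ q.2} =
      {q | ‖⟪(q.1 : H), (q.2 : H)⟫_ℂ‖ = ‖(q.1 : H)‖ * ‖(q.2 : H)‖} := by
    ext ⟨v, w⟩
    simp only [Set.mem_ofPred_eq, Projectivization.mk'_eq_mk]
    rw [norm_inner_eq_norm_iff v.2 w.2, eq_comm, Projectivization.mk_eq_mk_iff']
    constructor
    · rintro ⟨r, hr⟩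
      exact ⟨r, fun h => w.2 (by simp [← hr, h]), hr.symm⟩
    · rintro ⟨r, -, hr⟩
      exact ⟨r, hr.symm⟩
  rw [this]
  exact isClosed_eq (by fun_prop) (by fun_prop)

instance instCompactSpaceProj [FiniteDimensional ℂ H] : CompactSpace (ℙ ℂ H) := by
  have : ProperSpace H := FiniteDimensional.proper ℂ H
  let f : Metric.sphere (0 : H) 1 → {v : H // v ≠ 0} :=
    fun v => ⟨v, ne_zero_of_mem_unit_sphere v⟩
  have hf : Continuous f := Continuous.subtype_mk continuous_subtype_val _
  have hsurj : Function.Surjective (Projectivization.mk' ℂ (V := H) ∘ f) := by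
    intro p
    have h0 : ‖p.rep‖ ≠ 0 := norm_ne_zero_iff.2 p.rep_nonzero
    refine ⟨⟨((‖p.rep‖⁻¹ : ℝ) : ℂ) • p.rep, ?_⟩, ?_⟩
    · simp [norm_smul, h0]
    · conv_rhs => rw [← p.mk_rep]
      exact (Projectivization.mk_eq_mk_iff' ℂ _ _ _ _).2 ⟨_, rfl⟩
  exact hsurj.compactSpace (isOpenQuotientMap_mk'.continuous.comp hf)

variable (H) in
/-- The model space `ℂⁿ⁻¹` of the projective space of an `n`-dimensional space. -/
abbrev CPModel : Type := EuclideanSpace ℂ (Fin (Module.finrank ℂ H - 1))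

/-- A unit vector on the line `p`. -/
def unitRep (p : ℙ ℂ H) : H := ((‖p.rep‖⁻¹ : ℝ) : ℂ) • p.rep

theorem norm_unitRep (p : ℙ ℂ H) : ‖unitRep p‖ = 1 := by
  have h0 : ‖p.rep‖ ≠ 0 := norm_ne_zero_iff.2 p.rep_nonzero
  simp [unitRep, norm_smul, h0]

theorem unitRep_ne_zero (p : ℙ ℂ H) : unitRep p ≠ 0 := by
  rw [← norm_ne_zero_iff, norm_unitRep]; exact one_ne_zero

theorem mk_unitRep (p : ℙ ℂ H) : Projectivization.mk ℂ (unitRep p) (unitRep_ne_zero p) = p := by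
  conv_rhs => rw [← p.mk_rep]
  exact (Projectivization.mk_eq_mk_iff' ℂ _ _ _ _).2 ⟨_, rfl⟩

theorem inner_unitRep_self (p : ℙ ℂ H) : ⟪unitRep p, unitRep p⟫_ℂ = 1 := by
  rw [inner_self_eq_norm_sq_to_K, norm_unitRep]; simp

theorem rep_mk_eq (v : H) (hv : v ≠ 0) :
    ∃ a : ℂ, a ≠ 0 ∧ (Projectivization.mk ℂ v hv).rep = a • v := by
  obtain ⟨a, ha⟩ := Projectivization.exists_smul_eq_mk_rep ℂ v hv
  exact ⟨a, a.ne_zero, ha.symm⟩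

theorem inner_rep_mk_ne_zero (u v : H) (hv : v ≠ 0) :
    ⟪u, (Projectivization.mk ℂ v hv).rep⟫_ℂ ≠ 0 ↔ ⟪u, v⟫_ℂ ≠ 0 := by
  obtain ⟨a, ha, h⟩ := rep_mk_eq v hv
  rw [h, inner_smul_right]
  simp [ha]

variable [FiniteDimensional ℂ H]

theorem finrank_orthogonal_unitRep (p : ℙ ℂ H) :
    Module.finrank ℂ (ℂ ∙ unitRep p)ᗮ = Module.finrank ℂ H - 1 := by
  have h := Submodule.finrank_add_finrank_orthogonal (ℂ ∙ unitRep p)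
  rw [finrank_span_singleton (unitRep_ne_zero p)] at h
  omega

/-- A unitary identification of the model space with the orthogonal complement of the line `p`. -/
def frame (p : ℙ ℂ H) : CPModel H ≃ₗᵢ[ℂ] (ℂ ∙ unitRep p)ᗮ :=
  ((stdOrthonormalBasis ℂ (ℂ ∙ unitRep p)ᗮ).reindex
    (finCongr (finrank_orthogonal_unitRep p))).repr.symm

/-- The model space embedded isometrically in `H` as the orthogonal complement of `p`. -/
def horLift (p : ℙ ℂ H) : CPModel H →L[ℂ] H :=
  (ℂ ∙ unitRep p)ᗮ.subtypeL ∘L (frame p : CPModel H →L[ℂ] (ℂ ∙ unitRep p)ᗮ)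

/-- The orthogonal projection of `H` to the orthogonal complement of `p`, read in the model
space. -/
def horCoord (p : ℙ ℂ H) : H →L[ℂ] CPModel H :=
  ((frame p).symm : (ℂ ∙ unitRep p)ᗮ →L[ℂ] CPModel H) ∘L (ℂ ∙ unitRep p)ᗮ.orthogonalProjectionOnto

theorem inner_unitRep_horLift (p : ℙ ℂ H) (w : CPModel H) : ⟪unitRep p, horLift p w⟫_ℂ = 0 :=
  Submodule.mem_orthogonal_singleton_iff_inner_right.1 (frame p w).2

theorem inner_horLift (p : ℙ ℂ H) (w w' : CPModel H) :
    ⟪horLift p w, horLift p w'⟫_ℂ = ⟪w, w'⟫_ℂ :=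
  (frame p).inner_map_map w w'

theorem horCoord_horLift (p : ℙ ℂ H) (w : CPModel H) : horCoord p (horLift p w) = w := by
  simp [horCoord, horLift]

theorem horLift_horCoord (p : ℙ ℂ H) (v : H) :
    horLift p (horCoord p v) = v - ⟪unitRep p, v⟫_ℂ • unitRep p := by
  have h : horLift p (horCoord p v) = ((ℂ ∙ unitRep p)ᗮ.orthogonalProjectionOnto v : H) := by
    simp [horCoord, horLift]
  rw [h, ← Submodule.starProjection_unit_singleton ℂ (norm_unitRep p),
    Submodule.orthogonalProjectionOnto_orthogonal]

theorem horCoord_unitRep (p : ℙ ℂ H) : horCoord p (unitRep p) = 0 := by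
  have h := horLift_horCoord p (unitRep p)
  rw [inner_unitRep_self, one_smul, sub_self] at h
  have h2 := horCoord_horLift p (horCoord p (unitRep p))
  rw [h, map_zero] at h2
  exact h2.symm

theorem base_add_horLift_ne_zero (p : ℙ ℂ H) (w : CPModel H) : unitRep p + horLift p w ≠ 0 := by
  intro h
  have h2 : ⟪unitRep p, unitRep p + horLift p w⟫_ℂ = 1 := by
    rw [inner_add_right, inner_unitRep_self, inner_unitRep_horLift, add_zero]
  rw [h, inner_zero_right] at h2
  exact zero_ne_one h2

/-- The affine coordinate of the line spanned by `v`, in the chart centred at `p`. -/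
def affineMap (p : ℙ ℂ H) (v : H) : CPModel H := (⟪unitRep p, v⟫_ℂ)⁻¹ • horCoord p v

theorem affineMap_smul (p : ℙ ℂ H) (a : ℂ) (ha : a ≠ 0) (v : H) :
    affineMap p (a • v) = affineMap p v := by
  rw [affineMap, affineMap, inner_smul_right, map_smul, smul_smul, mul_inv, mul_comm a⁻¹,
    mul_assoc, inv_mul_cancel₀ ha, mul_one]

theorem affineMap_rep_mk (p : ℙ ℂ H) (v : H) (hv : v ≠ 0) :
    affineMap p (Projectivization.mk ℂ v hv).rep = affineMap p v := by
  obtain ⟨a, ha, h⟩ := rep_mk_eq v hv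
  rw [h, affineMap_smul p a ha]

theorem continuousOn_affineMap (p : ℙ ℂ H) :
    ContinuousOn (affineMap p) {v | ⟪unitRep p, v⟫_ℂ ≠ 0} := by
  refine ContinuousOn.smul (ContinuousOn.inv₀ (by fun_prop) fun v hv => hv) ?_
  exact (horCoord p).continuous.continuousOn

/-- The affine chart centred at `p`: the line spanned by `unitRep p + w` with `w` orthogonal to
`p` has coordinate `w`. It is defined on the lines that are not orthogonal to `p`. -/
def affineChart (p : ℙ ℂ H) : OpenPartialHomeomorph (ℙ ℂ H) (CPModel H) where
  toFun x := affineMap p x.rep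
  invFun w := Projectivization.mk ℂ (unitRep p + horLift p w) (base_add_horLift_ne_zero p w)
  source := {x | ⟪unitRep p, x.rep⟫_ℂ ≠ 0}
  target := Set.univ
  map_source' _ _ := Set.mem_univ _
  map_target' w _ := by
    rw [Set.mem_ofPred_eq, inner_rep_mk_ne_zero, inner_add_right, inner_unitRep_self,
      inner_unitRep_horLift, add_zero]
    exact one_ne_zero
  left_inv' x hx := by
    have hx' : ⟪unitRep p, x.rep⟫_ℂ ≠ 0 := hx
    conv_rhs => rw [← x.mk_rep]
    refine (Projectivization.mk_eq_mk_iff' ℂ _ _ _ _).2 ⟨(⟪unitRep p, x.rep⟫_ℂ)⁻¹, ?_⟩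
    rw [affineMap, map_smul, horLift_horCoord, smul_sub, smul_smul, inv_mul_cancel₀ hx', one_smul]
    abel
  right_inv' w _ := by
    rw [affineMap_rep_mk, affineMap, inner_add_right, inner_unitRep_self,
      inner_unitRep_horLift, add_zero, inv_one, one_smul, map_add, horCoord_unitRep, zero_add,
      horCoord_horLift]
  open_source := by
    rw [← isOpenQuotientMap_mk'.isQuotientMap.isOpen_preimage]
    have : Projectivization.mk' ℂ ⁻¹' {x : ℙ ℂ H | ⟪unitRep p, x.rep⟫_ℂ ≠ 0} =
        {v : {v : H // v ≠ 0} | ⟪unitRep p, (v : H)⟫_ℂ ≠ 0} := by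
      ext v
      exact inner_rep_mk_ne_zero (unitRep p) v v.2
    rw [this]
    exact isOpen_ne_fun (by fun_prop) continuous_const
  open_target := isOpen_univ
  continuousOn_toFun := by
    have hs : IsOpen {x : ℙ ℂ H | ⟪unitRep p, x.rep⟫_ℂ ≠ 0} := by
      rw [← isOpenQuotientMap_mk'.isQuotientMap.isOpen_preimage]
      have : Projectivization.mk' ℂ ⁻¹' {x : ℙ ℂ H | ⟪unitRep p, x.rep⟫_ℂ ≠ 0} =
          {v : {v : H // v ≠ 0} | ⟪unitRep p, (v : H)⟫_ℂ ≠ 0} := by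
        ext v
        exact inner_rep_mk_ne_zero (unitRep p) v v.2
      rw [this]
      exact isOpen_ne_fun (by fun_prop) continuous_const
    rw [isOpenQuotientMap_mk'.isQuotientMap.continuousOn_isOpen_iff hs]
    have h := (continuousOn_affineMap p).comp (t := {v | ⟪unitRep p, v⟫_ℂ ≠ 0})
      (s := Projectivization.mk' ℂ ⁻¹' {x : ℙ ℂ H | ⟪unitRep p, x.rep⟫_ℂ ≠ 0})
      (continuous_subtype_val (p := fun v : H => v ≠ 0)).continuousOn
      (fun v hv => (inner_rep_mk_ne_zero (unitRep p) v v.2).1 hv)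
    exact h.congr fun v _ => affineMap_rep_mk p v v.2
  continuousOn_invFun := by
    refine Continuous.continuousOn ?_
    refine isOpenQuotientMap_mk'.continuous.comp (Continuous.subtype_mk ?_ _)
    exact continuous_const.add (horLift p).continuous

theorem affineChart_mk (p : ℙ ℂ H) (v : H) (hv : v ≠ 0) :
    affineChart p (Projectivization.mk ℂ v hv) = affineMap p v :=
  affineMap_rep_mk p v hv

instance instChartedSpaceProj : ChartedSpace (CPModel H) (ℙ ℂ H) where
  atlas := Set.range affineChart
  chartAt := affineChart
  mem_chart_source p := by
    change ⟪unitRep p, p.rep⟫_ℂ ≠ 0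
    have h := (inner_rep_mk_ne_zero (unitRep p) (unitRep p) (unitRep_ne_zero p)).2
      (by rw [inner_unitRep_self]; exact one_ne_zero)
    rwa [mk_unitRep] at h
  chart_mem_atlas p := Set.mem_range_self p

theorem contDiffOn_affineChart_trans (p q : ℙ ℂ H) :
    ContDiffOn ℂ ω ((affineChart p).symm ≫ₕ affineChart q)
      ((affineChart p).symm ≫ₕ affineChart q).source := by
  have h : Set.EqOn ((affineChart p).symm ≫ₕ affineChart q)
      (fun w => affineMap q (unitRep p + horLift p w)) Set.univ := fun w _ =>
    affineMap_rep_mk q _ _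
  refine ContDiffOn.congr ?_ (h.mono (Set.subset_univ _))
  have h1 : ContDiff ℂ ω fun w : CPModel H => unitRep p + horLift p w :=
    contDiff_const.add (horLift p).contDiff
  have h2 : ContDiff ℂ ω fun w : CPModel H => ⟪unitRep q, unitRep p + horLift p w⟫_ℂ :=
    (innerSL ℂ (unitRep q) : H →L[ℂ] ℂ).contDiff.comp h1
  refine ContDiffOn.smul (h2.contDiffOn.inv ?_) ?_
  · rintro w ⟨-, hw⟩
    exact (inner_rep_mk_ne_zero (unitRep q) _ _).1 hw
  · exact ((horCoord q).contDiff.comp h1).contDiffOn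

/-- Projective space is a complex manifold: the transition maps are holomorphic. -/
instance instIsManifoldComplexProj : IsManifold 𝓘(ℂ, CPModel H) ω (ℙ ℂ H) := by
  refine isManifold_of_contDiffOn _ _ _ ?_
  rintro _ _ ⟨p, rfl⟩ ⟨q, rfl⟩
  simpa using contDiffOn_affineChart_trans p q

/-- The underlying real manifold. -/
instance instIsManifoldRealProj : IsManifold 𝓘(ℝ, CPModel H) ω (ℙ ℂ H) := by
  refine isManifold_of_contDiffOn _ _ _ ?_
  rintro _ _ ⟨p, rfl⟩ ⟨q, rfl⟩
  simpa using (contDiffOn_affineChart_trans p q).restrict_scalars ℝ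

/-! ### The Fubini–Study Kähler structure -/

variable (H) in
/-- The vector fields on the projective space, viewed as a real manifold. -/
abbrev CPVectorField : Type _ := (p : ℙ ℂ H) → TangentSpace 𝓘(ℝ, CPModel H) p

/-- The complex structure `J`. The chart that identifies the tangent space at `p` with the model
space is holomorphic, so that `J` is multiplication by `i` there. -/
def complexStructure (p : ℙ ℂ H) :
    TangentSpace 𝓘(ℝ, CPModel H) p →L[ℝ] TangentSpace 𝓘(ℝ, CPModel H) p :=
  ((Complex.I • ContinuousLinearMap.id ℂ (CPModel H)).restrictScalars ℝ :
    CPModel H →L[ℝ] CPModel H)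

/-- The Hermitian form `⟨u|v⟩ / ⟨ψ|ψ⟩ - ⟨u|ψ⟩⟨ψ|v⟩ / ⟨ψ|ψ⟩²` on `H` (the pullback of the
Fubini–Study tensor to the nonzero vectors). -/
def fubiniStudyForm (ψ u v : H) : ℂ :=
  ⟪u, v⟫_ℂ / ⟪ψ, ψ⟫_ℂ - ⟪u, ψ⟫_ℂ * ⟪ψ, v⟫_ℂ / ⟪ψ, ψ⟫_ℂ ^ 2

/-- The Fubini–Study metric `g`, evaluated on lifts of the tangent vectors to a unit vector on the
line `p`; see `fubiniStudyMetric_mfderiv_proj` for arbitrary lifts. -/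
def fubiniStudyMetric (p : ℙ ℂ H) (x y : TangentSpace 𝓘(ℝ, CPModel H) p) : ℝ :=
  (fubiniStudyForm (unitRep p) (horLift p x) (horLift p y)).re

/-- The symplectic form `ω(x, y) = g(x, J y)`. -/
def fubiniStudySymplectic (p : ℙ ℂ H) (x y : TangentSpace 𝓘(ℝ, CPModel H) p) : ℝ :=
  fubiniStudyMetric p x (complexStructure p y)

variable (H) in
/-- The open set of nonzero vectors. -/
def nonzeroVectors : TopologicalSpace.Opens H := ⟨{v | v ≠ 0}, isOpen_ne⟩

/-- The canonical projection from the nonzero vectors to the projective space. -/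
def proj (ψ : nonzeroVectors H) : ℙ ℂ H := Projectivization.mk ℂ (ψ : H) ψ.2

theorem eq_smul_unitRep_proj (ψ : nonzeroVectors H) :
    (ψ : H) = ⟪unitRep (proj ψ), (ψ : H)⟫_ℂ • unitRep (proj ψ) := by
  obtain ⟨a, ha⟩ := (Projectivization.mk_eq_mk_iff' ℂ _ _ ψ.2 (unitRep_ne_zero _)).1
    (mk_unitRep (proj ψ)).symm
  conv_rhs => rw [← ha, inner_smul_right, inner_unitRep_self, mul_one]
  exact ha.symm

theorem inner_unitRep_proj_ne_zero (ψ : nonzeroVectors H) :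
    ⟪unitRep (proj ψ), (ψ : H)⟫_ℂ ≠ 0 := by
  intro h
  have h2 := eq_smul_unitRep_proj ψ
  rw [h, zero_smul] at h2
  exact ψ.2 h2

/-- The differential of the canonical projection. -/
theorem hasMFDerivAt_proj (ψ : nonzeroVectors H) :
    HasMFDerivAt 𝓘(ℝ, H) 𝓘(ℝ, CPModel H) proj ψ
      (((⟪unitRep (proj ψ), (ψ : H)⟫_ℂ)⁻¹ • horCoord (proj ψ)).restrictScalars ℝ :
        H →L[ℝ] CPModel H) := by
  refine ⟨?_, ?_⟩
  · exact (isOpenQuotientMap_mk' (H := H)).continuous.continuousAt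
  have hc := inner_unitRep_proj_ne_zero ψ
  have hd : HasFDerivAt (𝕜 := ℂ) (affineMap (proj ψ))
      ((⟪unitRep (proj ψ), (ψ : H)⟫_ℂ)⁻¹ • horCoord (proj ψ)) (ψ : H) := by
    have h1 : HasFDerivAt (𝕜 := ℂ) (fun v : H => ⟪unitRep (proj ψ), v⟫_ℂ)
      (innerSL ℂ (unitRep (proj ψ))) (ψ : H) := (innerSL ℂ (unitRep (proj ψ))).hasFDerivAt
    have h2 := (hasFDerivAt_inv hc).comp (ψ : H) h1
    have h3 := h2.smul (horCoord (proj ψ)).hasFDerivAt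
    refine h3.congr_fderiv ?_
    have h0 : horCoord (proj ψ) (ψ : H) = 0 := by
      rw [eq_smul_unitRep_proj ψ, map_smul, horCoord_unitRep, smul_zero]
    ext v
    simp [h0]
  have hd' := hd.restrictScalars ℝ
  have he := TopologicalSpace.Opens.chartAt_subtype_val_symm_eventuallyEq (H := H)
    (nonzeroVectors H) (x := ψ)
  rw [chartAt_self_eq] at he
  have hw : writtenInExtChartAt 𝓘(ℝ, H) 𝓘(ℝ, CPModel H) ψ proj =ᶠ[𝓝 (ψ : H)]
      affineMap (proj ψ) := by
    filter_upwards [he] with v hv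
    have hv' : v = (((chartAt H ψ).symm v : nonzeroVectors H) : H) := hv
    conv_rhs => rw [hv']
    exact affineMap_rep_mk (proj ψ) _ ((chartAt H ψ).symm v).2
  exact (hd'.congr_of_eventuallyEq hw).hasFDerivWithinAt

/-- The complex structure is multiplication by `i` on vectors of `H`. -/
theorem complexStructure_mfderiv_proj (ψ : nonzeroVectors H) (u : H) :
    complexStructure (proj ψ) (mfderiv 𝓘(ℝ, H) 𝓘(ℝ, CPModel H) proj ψ u) =
      mfderiv 𝓘(ℝ, H) 𝓘(ℝ, CPModel H) proj ψ (Complex.I • u) := by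
  rw [(hasMFDerivAt_proj ψ).mfderiv]
  change Complex.I • ((⟪unitRep (proj ψ), (ψ : H)⟫_ℂ)⁻¹ • horCoord (proj ψ) u) =
    (⟪unitRep (proj ψ), (ψ : H)⟫_ℂ)⁻¹ • horCoord (proj ψ) (Complex.I • u)
  rw [map_smul, smul_comm]

/-- Every tangent vector is the image of a vector of `H`. -/
theorem mfderiv_proj_surjective (ψ : nonzeroVectors H) :
    Function.Surjective (mfderiv 𝓘(ℝ, H) 𝓘(ℝ, CPModel H) proj ψ) := by
  rw [(hasMFDerivAt_proj ψ).mfderiv]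
  intro x
  refine ⟨(⟪unitRep (proj ψ), (ψ : H)⟫_ℂ • horLift (proj ψ) x : H), ?_⟩
  change (⟪unitRep (proj ψ), (ψ : H)⟫_ℂ)⁻¹ • horCoord (proj ψ)
    (⟪unitRep (proj ψ), (ψ : H)⟫_ℂ • horLift (proj ψ) x) = x
  rw [map_smul, smul_smul, inv_mul_cancel₀ (inner_unitRep_proj_ne_zero ψ), one_smul]
  exact horCoord_horLift _ _

/-- The pullback of the metric to the nonzero vectors. -/
theorem fubiniStudyMetric_mfderiv_proj (ψ : nonzeroVectors H) (u v : H) :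
    fubiniStudyMetric (proj ψ) (mfderiv 𝓘(ℝ, H) 𝓘(ℝ, CPModel H) proj ψ u)
      (mfderiv 𝓘(ℝ, H) 𝓘(ℝ, CPModel H) proj ψ v) = (fubiniStudyForm (ψ : H) u v).re := by
  rw [(hasMFDerivAt_proj ψ).mfderiv]
  have hc := inner_unitRep_proj_ne_zero ψ
  have hψ := eq_smul_unitRep_proj ψ
  set p := proj ψ
  set c := ⟪unitRep p, (ψ : H)⟫_ℂ
  change (fubiniStudyForm (unitRep p) (horLift p (c⁻¹ • horCoord p u))
    (horLift p (c⁻¹ • horCoord p v))).re = _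
  congr 1
  have h1 := inner_unitRep_self p
  have hcc : (starRingEnd ℂ) c ≠ 0 := (map_ne_zero _).2 hc
  rw [map_smul, map_smul, horLift_horCoord, horLift_horCoord, hψ]
  simp only [fubiniStudyForm, inner_smul_left, inner_smul_right, inner_sub_left, inner_sub_right,
    h1, inner_conj_symm, map_inv₀]
  field_simp
  ring

/-- The pullback of the symplectic form to the nonzero vectors. -/
theorem fubiniStudySymplectic_mfderiv_proj (ψ : nonzeroVectors H) (u v : H) :
    fubiniStudySymplectic (proj ψ) (mfderiv 𝓘(ℝ, H) 𝓘(ℝ, CPModel H) proj ψ u)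
      (mfderiv 𝓘(ℝ, H) 𝓘(ℝ, CPModel H) proj ψ v) = (fubiniStudyForm (ψ : H) v u).im := by
  rw [fubiniStudySymplectic, complexStructure_mfderiv_proj, fubiniStudyMetric_mfderiv_proj]
  have h : fubiniStudyForm (ψ : H) u (Complex.I • v) =
      Complex.I * (starRingEnd ℂ) (fubiniStudyForm (ψ : H) v u) := by
    simp only [fubiniStudyForm, inner_smul_right, map_sub, map_div₀, map_mul, map_pow,
      inner_conj_symm]
    ring
  rw [h]
  simp

/-! ### The groups `SU(H)`, `SL(H)` and their Lie algebras -/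

variable (H) in
/-- The complex Lie algebra `𝔰𝔩(H)` of traceless operators. -/
def slAlgebra : LieSubalgebra ℂ (H →L[ℂ] H) where
  carrier := {S | LinearMap.trace ℂ H (S : H →ₗ[ℂ] H) = 0}
  add_mem' {S T} hS hT := by
    rw [Set.mem_ofPred_eq] at *
    rw [ContinuousLinearMap.toLinearMap_add, map_add, hS, hT, add_zero]
  zero_mem' := by
    rw [Set.mem_ofPred_eq, ContinuousLinearMap.toLinearMap_zero, map_zero]
  smul_mem' c S hS := by
    rw [Set.mem_ofPred_eq] at *
    rw [ContinuousLinearMap.toLinearMap_smul, map_smul, hS, smul_zero]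
  lie_mem' {S T} _ _ := by
    change LinearMap.trace ℂ H ((S * T - T * S : H →L[ℂ] H) : H →ₗ[ℂ] H) = 0
    rw [ContinuousLinearMap.toLinearMap_sub, map_sub, ContinuousLinearMap.toLinearMap_mul,
      ContinuousLinearMap.toLinearMap_mul, LinearMap.trace_mul_comm, sub_self]

variable (H) in
/-- The real Lie algebra `𝔰𝔲(H)` of traceless skew-adjoint operators. -/
def suAlgebra : LieSubalgebra ℝ (H →L[ℂ] H) where
  carrier := {A | star A = -A ∧ LinearMap.trace ℂ H (A : H →ₗ[ℂ] H) = 0}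
  add_mem' {A B} hA hB := by
    refine ⟨?_, (slAlgebra H).add_mem hA.2 hB.2⟩
    rw [star_add, hA.1, hB.1, neg_add]
  zero_mem' := ⟨by rw [star_zero, neg_zero], (slAlgebra H).zero_mem⟩
  smul_mem' c A hA := by
    refine ⟨?_, (slAlgebra H).smul_mem (c : ℂ) hA.2⟩
    change star ((c : ℂ) • A) = -((c : ℂ) • A)
    rw [star_smul, hA.1, smul_neg]
    simp
  lie_mem' {A B} hA hB := by
    refine ⟨?_, (slAlgebra H).lie_mem hA.2 hB.2⟩
    rw [Ring.lie_def, star_sub, star_mul, star_mul, hA.1, hB.1]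
    noncomm_ring

/-- The inclusion of `𝔰𝔲(H)` in `𝔰𝔩(H)`. -/
def suToSl (A : suAlgebra H) : slAlgebra H := ⟨A, A.2.2⟩

theorem differentiable_det : Differentiable ℂ
    (fun T : H →L[ℂ] H => LinearMap.det (T : H →ₗ[ℂ] H)) := by
  let b := Module.finBasis ℂ H
  have h : (fun T : H →L[ℂ] H => LinearMap.det (T : H →ₗ[ℂ] H)) = fun T =>
      ∑ σ : Equiv.Perm (Fin (Module.finrank ℂ H)), (Equiv.Perm.sign σ : ℤ) •
        ∏ i, b.repr (T (b i)) (σ i) := by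
    funext T
    rw [← LinearMap.det_toMatrix b, Matrix.det_apply]
    simp [LinearMap.toMatrix_apply, Units.smul_def]
  rw [h]
  have hl : ∀ i j, Differentiable ℂ fun T : H →L[ℂ] H => b.repr (T (b i)) j := fun i j =>
    (LinearMap.toContinuousLinearMap ((b.coord j) ∘ₗ (LinearMap.applyₗ (b i)) ∘ₗ
      (ContinuousLinearMap.coeLM ℂ : (H →L[ℂ] H) →ₗ[ℂ] (H →ₗ[ℂ] H)))).differentiable
  fun_prop

theorem fderiv_det_one (S : H →L[ℂ] H) :
    fderiv ℂ (fun T : H →L[ℂ] H => LinearMap.det (T : H →ₗ[ℂ] H)) 1 S =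
      LinearMap.trace ℂ H (S : H →ₗ[ℂ] H) := by
  let b := Module.finBasis ℂ H
  have h1 : HasDerivAt (fun t : ℂ => (1 : H →L[ℂ] H) + t • S) S 0 := by
    simpa using ((hasDerivAt_id (0 : ℂ)).smul_const S).const_add (1 : H →L[ℂ] H)
  have h2 : HasFDerivAt (fun T : H →L[ℂ] H => LinearMap.det (T : H →ₗ[ℂ] H))
      (fderiv ℂ (fun T : H →L[ℂ] H => LinearMap.det (T : H →ₗ[ℂ] H)) 1)
      ((1 : H →L[ℂ] H) + (0 : ℂ) • S) := by
    rw [zero_smul, add_zero]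
    exact (differentiable_det 1).hasFDerivAt
  have h3 := h2.comp_hasDerivAt 0 h1
  let M := LinearMap.toMatrix b b (S : H →ₗ[ℂ] H)
  let P := (1 + (Polynomial.X : Polynomial ℂ) • M.map Polynomial.C).det.divX.divX
  have h4 : ((fun T : H →L[ℂ] H => LinearMap.det (T : H →ₗ[ℂ] H)) ∘
      fun t : ℂ => (1 : H →L[ℂ] H) + t • S) =
      fun t => 1 + M.trace * t + P.eval t * t ^ 2 := by
    funext t
    rw [← Matrix.det_one_add_smul, Function.comp_apply, ← LinearMap.det_toMatrix b]
    congr 1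
    rw [ContinuousLinearMap.toLinearMap_add, ContinuousLinearMap.toLinearMap_smul, map_add,
      map_smul]
    congr 1
    exact LinearMap.toMatrix_one b
  rw [h4] at h3
  have h5 : HasDerivAt (fun t : ℂ => 1 + M.trace * t + P.eval t * t ^ 2) M.trace 0 := by
    have := (((hasDerivAt_id (0 : ℂ)).const_mul M.trace).const_add 1).add
      ((P.hasDerivAt 0).mul ((hasDerivAt_id (0 : ℂ)).pow 2))
    simpa using! this
  rw [h3.unique h5, LinearMap.trace_eq_matrix_trace ℂ b]

theorem det_exp_of_trace_eq_zero (S : H →L[ℂ] H)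
    (hS : LinearMap.trace ℂ H (S : H →ₗ[ℂ] H) = 0) :
    LinearMap.det (NormedSpace.exp S : H →L[ℂ] H).toLinearMap = 1 := by
  let : NormedAlgebra ℚ (H →L[ℂ] H) := NormedAlgebra.restrictScalars ℚ ℂ _
  let f : ℂ → ℂ := fun t => LinearMap.det (NormedSpace.exp (t • S) : H →L[ℂ] H).toLinearMap
  have hadd : ∀ s t, f (s + t) = f s * f t := by
    intro s t
    simp only [f]
    rw [add_smul, NormedSpace.exp_add_of_commute
      ((Commute.refl S).smul_left s |>.smul_right t), ContinuousLinearMap.toLinearMap_mul, map_mul]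
  have h0 : f 0 = 1 := by
    simp [f, NormedSpace.exp_zero]
  have hf0 : HasDerivAt f 0 0 := by
    have h1 := hasDerivAt_exp_smul_const (𝕂 := ℂ) S 0
    rw [zero_smul, NormedSpace.exp_zero, one_mul] at h1
    have h2 : HasFDerivAt (fun T : H →L[ℂ] H => LinearMap.det (T : H →ₗ[ℂ] H))
        (fderiv ℂ (fun T : H →L[ℂ] H => LinearMap.det (T : H →ₗ[ℂ] H)) 1)
        (NormedSpace.exp ((0 : ℂ) • S)) := by
      rw [zero_smul, NormedSpace.exp_zero]
      exact (differentiable_det 1).hasFDerivAt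
    have h3 := h2.comp_hasDerivAt 0 h1
    rwa [fderiv_det_one, hS] at h3
  have hf : ∀ t, HasDerivAt f 0 t := by
    intro t
    have h1 : HasDerivAt (fun s => f t * f (s - t)) (f t * 0) t := by
      refine HasDerivAt.const_mul _ ?_
      have h2 : HasDerivAt f 0 (t - t) := by rwa [sub_self]
      exact h2.comp_sub_const t t
    rw [mul_zero] at h1
    refine h1.congr_of_eventuallyEq (Filter.Eventually.of_forall fun s => ?_)
    change f s = f t * f (s - t)
    rw [← hadd, add_sub_cancel]
  have hc := is_const_of_deriv_eq_zero (fun t => (hf t).differentiableAt) (fun t => (hf t).deriv) 1 0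
  rw [h0] at hc
  simpa [f] using hc

/-- The exponential map `𝔰𝔩(H) → SL(H)`. -/
def slExp (S : slAlgebra H) : SpecialLinearGroup ℂ H :=
  ⟨LinearEquiv.ofLinearMap (NormedSpace.exp (S : H →L[ℂ] H)).toLinearMap
    (NormedSpace.exp (-S : H →L[ℂ] H)).toLinearMap
    (by
      let : NormedAlgebra ℚ (H →L[ℂ] H) := NormedAlgebra.restrictScalars ℚ ℂ _
      have h : NormedSpace.exp (S : H →L[ℂ] H) * NormedSpace.exp (-S : H →L[ℂ] H) = 1 := by
        rw [← NormedSpace.exp_add_of_commute (Commute.refl (S : H →L[ℂ] H)).neg_right,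
          add_neg_cancel, NormedSpace.exp_zero]
      exact congrArg ContinuousLinearMap.toLinearMap h)
    (by
      let : NormedAlgebra ℚ (H →L[ℂ] H) := NormedAlgebra.restrictScalars ℚ ℂ _
      have h : NormedSpace.exp (-S : H →L[ℂ] H) * NormedSpace.exp (S : H →L[ℂ] H) = 1 := by
        rw [← NormedSpace.exp_add_of_commute (Commute.refl (S : H →L[ℂ] H)).neg_left,
          neg_add_cancel, NormedSpace.exp_zero]
      exact congrArg ContinuousLinearMap.toLinearMap h), by
    rw [← Units.val_inj, LinearEquiv.coe_det]
    exact det_exp_of_trace_eq_zero _ S.2⟩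

theorem slExp_apply (S : slAlgebra H) (v : H) :
    slExp S v = NormedSpace.exp (S : H →L[ℂ] H) v := rfl

variable (H) in
/-- The special unitary group, as a subgroup of `SL(H)`. -/
def SUGroup : Subgroup (SpecialLinearGroup ℂ H) where
  carrier := {g | ∀ v w : H, ⟪g v, g w⟫_ℂ = ⟪v, w⟫_ℂ}
  mul_mem' {g h} hg hh v w := (hg _ _).trans (hh v w)
  one_mem' _ _ := rfl
  inv_mem' {g} hg v w := by
    have h := hg (g⁻¹ v) (g⁻¹ w)
    have hv : ∀ x : H, g (g⁻¹ x) = x := fun x => g.1.apply_symm_apply x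
    rw [hv, hv] at h
    exact h.symm

/-- The exponential map `𝔰𝔲(H) → SU(H)`. -/
def suExp (A : suAlgebra H) : SUGroup H :=
  ⟨slExp (suToSl A), fun v w => by
    let : NormedAlgebra ℚ (H →L[ℂ] H) := NormedAlgebra.restrictScalars ℚ ℂ _
    have h := NormedSpace.exp_mem_unitary_of_mem_skewAdjoint 
      ((skewAdjoint.mem_iff (R := H →L[ℂ] H)).2 A.2.1)
    have h2 := congrArg (fun T : H →L[ℂ] H => ⟪v, T w⟫_ℂ) (Unitary.star_mul_self_of_mem h)
    have h3 : ⟪NormedSpace.exp (A : H →L[ℂ] H) v, NormedSpace.exp (A : H →L[ℂ] H) w⟫_ℂ =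
        ⟪v, w⟫_ℂ := by
      simpa [ContinuousLinearMap.star_eq_adjoint, ContinuousLinearMap.adjoint_inner_right] using h2
    exact h3⟩

/-- The operator underlying an element of `SL(H)`. -/
def slOperator (g : SpecialLinearGroup ℂ H) : H →L[ℂ] H :=
  LinearMap.toContinuousLinearMap (g.1 : H →ₗ[ℂ] H)

/-! ### Hamiltonian and gradient vector fields -/

/-- The vector field `X_A` of the action of `SU(H)`: its value at `p` is the velocity at time `0` of
the curve `t ↦ exp(tA) · p`. -/
def fieldX (A : suAlgebra H) : CPVectorField H := fun p =>
  (mfderiv 𝓘(ℝ, ℝ) 𝓘(ℝ, CPModel H) (fun t : ℝ => suExp (t • A) • p) 0 (1 : ℝ) : CPModel H)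

/-- The vector field `Y_A = J(X_A)`. -/
def fieldY (A : suAlgebra H) : CPVectorField H := fun p => complexStructure p (fieldX A p)

/-- A vector field on the projective space is smooth. -/
def IsSmoothField (X : CPVectorField H) : Prop :=
  ContMDiff 𝓘(ℝ, CPModel H) 𝓘(ℝ, CPModel H).tangent ∞
    (fun p => (⟨p, X p⟩ : TangentBundle 𝓘(ℝ, CPModel H) (ℙ ℂ H)))

/-- `X` is the Hamiltonian vector field of the smooth function `f`: `df = ω(·, X)`. -/
def IsHamiltonianField (f : ℙ ℂ H → ℝ) (X : CPVectorField H) : Prop :=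
  ContMDiff 𝓘(ℝ, CPModel H) 𝓘(ℝ, ℝ) ∞ f ∧
    ∀ (p : ℙ ℂ H) (v : TangentSpace 𝓘(ℝ, CPModel H) p),
      mfderiv 𝓘(ℝ, CPModel H) 𝓘(ℝ, ℝ) f p v = fubiniStudySymplectic p v (X p)

/-- `Y` is the gradient vector field of the smooth function `f`: `df = g(·, Y)`. -/
def IsGradientField (f : ℙ ℂ H → ℝ) (Y : CPVectorField H) : Prop :=
  ContMDiff 𝓘(ℝ, CPModel H) 𝓘(ℝ, ℝ) ∞ f ∧
    ∀ (p : ℙ ℂ H) (v : TangentSpace 𝓘(ℝ, CPModel H) p),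
      mfderiv 𝓘(ℝ, CPModel H) 𝓘(ℝ, ℝ) f p v = fubiniStudyMetric p v (Y p)

/-- The expectation value function `[ψ] ↦ ⟨ψ|a ψ⟩ / ⟨ψ|ψ⟩`. -/
def expectation (a : H →L[ℂ] H) (p : ℙ ℂ H) : ℝ :=
  (⟪p.rep, a p.rep⟫_ℂ / ⟪p.rep, p.rep⟫_ℂ).re

theorem expectation_mk (a : H →L[ℂ] H) (ψ : H) (hψ : ψ ≠ 0) :
    expectation a (Projectivization.mk ℂ ψ hψ) = (⟪ψ, a ψ⟫_ℂ / ⟪ψ, ψ⟫_ℂ).re := by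
  obtain ⟨c, hc, h⟩ := rep_mk_eq ψ hψ
  have hcc : (starRingEnd ℂ) c ≠ 0 := (map_ne_zero _).2 hc
  have h0 : ⟪ψ, ψ⟫_ℂ ≠ 0 := inner_self_ne_zero.2 hψ
  rw [expectation, h]
  congr 1
  simp only [map_smul, inner_smul_left, inner_smul_right]
  field_simp

/-- The Lie bracket of vector fields. -/
def fieldBracket (X Y : CPVectorField H) : CPVectorField H :=
  VectorField.mlieBracket 𝓘(ℝ, CPModel H) X Y

/-- A group action of `SL(H)` on the projective space is smooth: near every point of
`SL(H) × P` it is the restriction of a smooth map on an open subset of `End(H) × P`. -/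
def IsSmoothAction (Φ : SpecialLinearGroup ℂ H →* Equiv.Perm (ℙ ℂ H)) : Prop :=
  ∀ (g : SpecialLinearGroup ℂ H) (p : ℙ ℂ H),
    ∃ U : Set ((H →L[ℂ] H) × ℙ ℂ H), IsOpen U ∧ (slOperator g, p) ∈ U ∧
      ∃ F : (H →L[ℂ] H) × ℙ ℂ H → ℙ ℂ H,
        ContMDiffOn (𝓘(ℝ, H →L[ℂ] H).prod 𝓘(ℝ, CPModel H)) 𝓘(ℝ, CPModel H) ∞ F U ∧
          ∀ (h : SpecialLinearGroup ℂ H) (q : ℙ ℂ H),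
            (slOperator h, q) ∈ U → F (slOperator h, q) = Φ h q

end

end QuantumGeometry

open QuantumGeometry

namespace QuantumGeometry

noncomputable section

variable {H : Type*} [NormedAddCommGroup H] [InnerProductSpace ℂ H]

/-! ### The projection as a map on the whole vector space -/

/-! Every operator `S` on `H` has a linear flow `exp(tS)`, which maps lines to lines. The linear
field `v ↦ S v` is homogeneous of degree one, so it descends to a field `operatorField S` on
projective space, with value `horCoord p (S u)` at `p`, where `u` is a unit vector on `p`. All
fields of the theorem have this form: `X_A` comes from `A`, and since `horCoord p` is complex linear
and `J` is multiplication by `i`, `Y_A` comes from `iA`. Hence `ζ` is just `S ↦ operatorField S`,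
and its integral curves are the projected linear flows.

Brackets are computed at the centre of a chart, which suffices because every point is the centre of
its own affine chart. There the field is a quadratic polynomial, its value and first derivative at
`0` determine the bracket, and the result is minus the field of the commutator
(`lieBracket_affineField_zero`, `fieldBracket_operatorField`). All three relations follow by
bilinearity and `i² = -1`. The gradient property is the derivative of the Rayleigh quotient in a
horizontal direction (`fderiv_rayleigh_apply`). A traceless operator whose field vanishes has only
eigenvectors, so it is scalar and therefore zero.

The projection is extended by a junk value at `0`, so that curves and derivatives can be handled in
the vector space `H` rather than in a subtype. -/

open Classical in
/-- The line spanned by `v`, with the value `p₀` at `v = 0`. -/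
def lineOr (p₀ : ℙ ℂ H) (v : H) : ℙ ℂ H :=
  if hv : v ≠ 0 then Projectivization.mk ℂ v hv else p₀

theorem lineOr_of_ne_zero (p₀ : ℙ ℂ H) {v : H} (hv : v ≠ 0) :
    lineOr p₀ v = Projectivization.mk ℂ v hv := dif_pos hv

theorem lineOr_unitRep (p₀ p : ℙ ℂ H) : lineOr p₀ (unitRep p) = p := by
  rw [lineOr_of_ne_zero p₀ (unitRep_ne_zero p), mk_unitRep]

theorem continuousOn_lineOr (p₀ : ℙ ℂ H) : ContinuousOn (lineOr p₀) {v | v ≠ 0} := by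
  rw [continuousOn_iff_continuous_domRestrict]
  refine (isOpenQuotientMap_mk' (H := H)).continuous.congr fun v => ?_
  exact (lineOr_of_ne_zero p₀ v.2).symm

theorem continuousAt_lineOr (p₀ : ℙ ℂ H) {v : H} (hv : v ≠ 0) : ContinuousAt (lineOr p₀) v :=
  (continuousOn_lineOr p₀).continuousAt (isOpen_ne.mem_nhds hv)

/-- Trades the action on lines for the linear motion of a fixed unit vector. The default `p₀` never
occurs because `g` is injective. -/
theorem smul_eq_lineOr (g : SpecialLinearGroup ℂ H) (p p₀ : ℙ ℂ H) :
    g • p = lineOr p₀ (g (unitRep p)) := by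
  have h : g (unitRep p) ≠ 0 := g.1.map_ne_zero_iff.2 (unitRep_ne_zero p)
  rw [lineOr_of_ne_zero p₀ h]
  conv_lhs => rw [← mk_unitRep p]
  rfl

theorem contDiffAt_rayleigh (a : H →L[ℂ] H) {v : H} (hv : v ≠ 0) {n : ℕ∞ω} :
    ContDiffAt ℝ n (fun v : H => (⟪v, a v⟫_ℂ / ⟪v, v⟫_ℂ).re) v := by
  have h1 : ContDiff ℝ n fun v : H => ⟪v, a v⟫_ℂ :=
    ContDiff.inner ℂ contDiff_fun_id (a.restrictScalars ℝ).contDiff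
  have h2 : ContDiff ℝ n fun v : H => ⟪v, v⟫_ℂ := ContDiff.inner ℂ contDiff_fun_id contDiff_fun_id
  have h3 : ContDiffAt ℝ n (fun v : H => ⟪v, a v⟫_ℂ * (⟪v, v⟫_ℂ)⁻¹) v :=
    h1.contDiffAt.mul (h2.contDiffAt.inv (inner_self_ne_zero.2 hv))
  simp only [div_eq_mul_inv]
  exact Complex.reCLM.contDiff.contDiffAt.comp v h3

variable [FiniteDimensional ℂ H]

/-- The derivative of the affine coordinate at a vector `v` that is not orthogonal to `p`. -/
def affineMapDeriv (p : ℙ ℂ H) (v : H) : H →L[ℂ] CPModel H :=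
  (⟪unitRep p, v⟫_ℂ)⁻¹ • horCoord p -
    (innerSL ℂ (unitRep p)).smulRight ((⟪unitRep p, v⟫_ℂ ^ 2)⁻¹ • horCoord p v)

theorem affineMapDeriv_apply (p : ℙ ℂ H) (v u : H) :
    affineMapDeriv p v u = (⟪unitRep p, v⟫_ℂ)⁻¹ • horCoord p u -
      (⟪unitRep p, u⟫_ℂ * (⟪unitRep p, v⟫_ℂ ^ 2)⁻¹) • horCoord p v := by
  simp [affineMapDeriv, smul_smul]

theorem hasFDerivAt_affineMap (p : ℙ ℂ H) {v : H} (hv : ⟪unitRep p, v⟫_ℂ ≠ 0) :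
    HasFDerivAt (𝕜 := ℂ) (affineMap p) (affineMapDeriv p v) v := by
  have h1 : HasFDerivAt (𝕜 := ℂ) (fun v : H => ⟪unitRep p, v⟫_ℂ)
    (innerSL ℂ (unitRep p)) v := (innerSL ℂ (unitRep p)).hasFDerivAt
  have h2 := (hasFDerivAt_inv hv).comp v h1
  have h3 := h2.smul (horCoord p).hasFDerivAt
  refine h3.congr_fderiv ?_
  ext1 u
  simp [affineMapDeriv_apply, sub_eq_add_neg]

theorem contDiffAt_affineMap (p : ℙ ℂ H) {v : H} (hv : ⟪unitRep p, v⟫_ℂ ≠ 0)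
    {n : ℕ∞ω} : ContDiffAt ℝ n (affineMap p) v := by
  have h2 : ContDiff ℂ n fun v : H => ⟪unitRep p, v⟫_ℂ :=
    (innerSL ℂ (unitRep p) : H →L[ℂ] ℂ).contDiff
  exact ((h2.contDiffAt.inv hv).smul (horCoord p).contDiff.contDiffAt).restrict_scalars ℝ

theorem eq_smul_unitRep_lineOr (p₀ : ℙ ℂ H) {v : H} (hv : v ≠ 0) :
    v = ⟪unitRep (lineOr p₀ v), v⟫_ℂ • unitRep (lineOr p₀ v) := by
  rw [lineOr_of_ne_zero p₀ hv]
  exact eq_smul_unitRep_proj (⟨v, hv⟩ : nonzeroVectors H)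

theorem inner_unitRep_lineOr_ne_zero (p₀ : ℙ ℂ H) {v : H} (hv : v ≠ 0) :
    ⟪unitRep (lineOr p₀ v), v⟫_ℂ ≠ 0 := by
  rw [lineOr_of_ne_zero p₀ hv]
  exact inner_unitRep_proj_ne_zero (⟨v, hv⟩ : nonzeroVectors H)

theorem horCoord_lineOr_self (p₀ : ℙ ℂ H) {v : H} (hv : v ≠ 0) :
    horCoord (lineOr p₀ v) v = 0 := by
  have h := congrArg (horCoord (lineOr p₀ v)) (eq_smul_unitRep_lineOr p₀ hv)
  rwa [map_smul, horCoord_unitRep, smul_zero] at h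

theorem affineChart_lineOr (p p₀ : ℙ ℂ H) {v : H} (hv : v ≠ 0) :
    affineChart p (lineOr p₀ v) = affineMap p v := by
  rw [lineOr_of_ne_zero p₀ hv, affineChart_mk]

theorem eventuallyEq_affineChart_lineOr (p p₀ : ℙ ℂ H) {v : H} (hv : v ≠ 0) :
    (fun u => affineChart p (lineOr p₀ u)) =ᶠ[𝓝 v] affineMap p := by
  filter_upwards [isOpen_ne.mem_nhds hv] with u hu using affineChart_lineOr p p₀ hu

theorem mem_source_affineChart_mk (p : ℙ ℂ H) {v : H} (hv : v ≠ 0) :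
    Projectivization.mk ℂ v hv ∈ (affineChart p).source ↔ ⟪unitRep p, v⟫_ℂ ≠ 0 :=
  inner_rep_mk_ne_zero (unitRep p) v hv

/-- The derivative at `v` of the map that sends a vector to the line spanned by it. -/
def lineDeriv (v : H) (p : ℙ ℂ H) : H →L[ℝ] TangentSpace 𝓘(ℝ, CPModel H) p :=
  (((⟪unitRep p, v⟫_ℂ)⁻¹ • horCoord p).restrictScalars ℝ : H →L[ℝ] CPModel H)

theorem hasMFDerivAt_lineOr (p₀ : ℙ ℂ H) {v : H} (hv : v ≠ 0) :
    HasMFDerivAt 𝓘(ℝ, H) 𝓘(ℝ, CPModel H) (lineOr p₀) v (lineDeriv v (lineOr p₀ v)) := by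
  refine ⟨continuousAt_lineOr p₀ hv, ?_⟩
  have hc := inner_unitRep_lineOr_ne_zero p₀ hv
  have hd := (hasFDerivAt_affineMap (lineOr p₀ v) hc).restrictScalars ℝ
  -- In the chart centred at the line of `v` itself, the second term of the quotient rule vanishes
  -- because `horCoord` kills `v`.
  have he : affineMapDeriv (lineOr p₀ v) v =
      (⟪unitRep (lineOr p₀ v), v⟫_ℂ)⁻¹ • horCoord (lineOr p₀ v) := by
    ext1 u
    simp [affineMapDeriv_apply, horCoord_lineOr_self p₀ hv]
  rw [he] at hd
  exact (hd.congr_of_eventuallyEq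
    (eventuallyEq_affineChart_lineOr (lineOr p₀ v) p₀ hv)).hasFDerivWithinAt

theorem contMDiffAt_lineOr (p₀ : ℙ ℂ H) {v : H} (hv : v ≠ 0) :
    ContMDiffAt 𝓘(ℝ, H) 𝓘(ℝ, CPModel H) ∞ (lineOr p₀) v := by
  rw [contMDiffAt_iff]
  refine ⟨continuousAt_lineOr p₀ hv, ?_⟩
  have hc := inner_unitRep_lineOr_ne_zero p₀ hv
  exact ((contDiffAt_affineMap (lineOr p₀ v) hc).congr_of_eventuallyEq
    (eventuallyEq_affineChart_lineOr (lineOr p₀ v) p₀ hv)).contDiffWithinAt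

theorem contMDiffAt_affineChart (p : ℙ ℂ H) {x : ℙ ℂ H} (hx : x ∈ (affineChart p).source) :
    ContMDiffAt 𝓘(ℝ, CPModel H) 𝓘(ℝ, CPModel H) ∞ (affineChart p) x :=
  contMDiffAt_extChartAt' (I := 𝓘(ℝ, CPModel H)) (x := p) hx

/-- The vector of affine coordinate `w` on the line with this coordinate. -/
def affineLift (p : ℙ ℂ H) (w : CPModel H) : H := unitRep p + horLift p w

theorem affineLift_ne_zero (p : ℙ ℂ H) (w : CPModel H) : affineLift p w ≠ 0 :=
  base_add_horLift_ne_zero p w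

theorem contDiff_affineLift (p : ℙ ℂ H) {n : ℕ∞ω} : ContDiff ℝ n (affineLift p) :=
  contDiff_const.add ((horLift p).restrictScalars ℝ).contDiff

theorem mk_affineLift_affineChart (p : ℙ ℂ H) {x : ℙ ℂ H} (hx : x ∈ (affineChart p).source) :
    Projectivization.mk ℂ (affineLift p (affineChart p x)) (affineLift_ne_zero p _) = x :=
  (affineChart p).left_inv hx

/-- The lift picks the representative whose component along `unitRep p` is `1`. -/
theorem affineLift_affineMap (p : ℙ ℂ H) {v : H} (hv : ⟪unitRep p, v⟫_ℂ ≠ 0) :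
    affineLift p (affineMap p v) = (⟪unitRep p, v⟫_ℂ)⁻¹ • v := by
  rw [affineLift, affineMap, map_smul, horLift_horCoord, smul_sub, smul_smul,
    inv_mul_cancel₀ hv, one_smul]
  abel

/-- The chart at `p` of the line spanned by a curve in `H` has the expected velocity. -/
theorem mfderiv_affineChart_lineDeriv (p p₀ : ℙ ℂ H) {v : H} (hv : v ≠ 0)
    (hp : ⟪unitRep p, v⟫_ℂ ≠ 0) (u : H) :
    mfderiv 𝓘(ℝ, CPModel H) 𝓘(ℝ, CPModel H) (affineChart p) (lineOr p₀ v)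
      (lineDeriv v (lineOr p₀ v) u) = affineMapDeriv p v u := by
  have hx : lineOr p₀ v ∈ (affineChart p).source := by
    rw [lineOr_of_ne_zero p₀ hv]
    exact (mem_source_affineChart_mk p hv).2 hp
  have h1 := ((contMDiffAt_affineChart p hx).mdifferentiableAt (by simp)).hasMFDerivAt.comp v
    (hasMFDerivAt_lineOr p₀ hv)
  have h2 : HasMFDerivAt 𝓘(ℝ, H) 𝓘(ℝ, CPModel H) (affineChart p ∘ lineOr p₀) v
      ((affineMapDeriv p v).restrictScalars ℝ : H →L[ℝ] CPModel H) :=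
    (((hasFDerivAt_affineMap p hp).restrictScalars ℝ).congr_of_eventuallyEq
      (eventuallyEq_affineChart_lineOr p p₀ hv)).hasMFDerivAt
  exact DFunLike.congr_fun (hasMFDerivAt_unique h1 h2) u

/-! ### The vector fields generated by operators -/

/-- The vector field on the projective space generated by an operator `S`. -/
def operatorField (S : H →L[ℂ] H) : CPVectorField H := fun p =>
  (horCoord p (S (unitRep p)) : CPModel H)

/-- The linear field `v ↦ S v` projects to `operatorField S` from any representative: if `v = c u`,
the factor `c` in `S v` cancels the `c⁻¹` in the differential of the projection. -/
theorem operatorField_lineOr (S : H →L[ℂ] H) (p₀ : ℙ ℂ H) {v : H} (hv : v ≠ 0) :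
    operatorField S (lineOr p₀ v) = lineDeriv v (lineOr p₀ v) (S v) := by
  have h := eq_smul_unitRep_lineOr p₀ hv
  have hc := inner_unitRep_lineOr_ne_zero p₀ hv
  change horCoord (lineOr p₀ v) (S (unitRep (lineOr p₀ v))) =
    (⟪unitRep (lineOr p₀ v), v⟫_ℂ)⁻¹ • horCoord (lineOr p₀ v) (S v)
  rw [← map_smul, ← map_smul]
  congr 2
  rw [eq_inv_smul_iff₀ hc]
  exact h.symm

/-! ### Operator fields in affine charts: smoothness and brackets. -/

/-- The vector field generated by `S` in the affine chart at `p`. -/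
def affineField (p : ℙ ℂ H) (S : H →L[ℂ] H) (w : CPModel H) : CPModel H :=
  horCoord p (S (affineLift p w)) - ⟪unitRep p, S (affineLift p w)⟫_ℂ • w

/-- The left side is homogeneous of degree zero in `v`, so it may be expressed through the
normalised lift of the affine coordinate. -/
theorem affineMapDeriv_operator (p : ℙ ℂ H) (S : H →L[ℂ] H) {v : H}
    (hv : ⟪unitRep p, v⟫_ℂ ≠ 0) :
    affineMapDeriv p v (S v) = affineField p S (affineMap p v) := by
  rw [affineMapDeriv_apply, affineField, affineLift_affineMap p hv, affineMap, map_smul, map_smul,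
    inner_smul_right, smul_smul]
  congr 2
  field_simp

/-- In the product with `w`, only the derivative of the factor `w` survives at `w = 0`. -/
theorem hasFDerivAt_affineField_zero (p : ℙ ℂ H) (S : H →L[ℂ] H) :
    HasFDerivAt (𝕜 := ℂ) (affineField p S)
      (horCoord p ∘L S ∘L horLift p - ⟪unitRep p, S (unitRep p)⟫_ℂ • ContinuousLinearMap.id ℂ _)
      0 := by
  have h1 : HasFDerivAt (𝕜 := ℂ) (fun w => S (affineLift p w)) (S ∘L horLift p) 0 :=
    S.hasFDerivAt.comp 0 ((horLift p).hasFDerivAt.const_add (unitRep p))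
  have h2 := (horCoord p).hasFDerivAt.comp 0 h1
  have h3 := (innerSL ℂ (unitRep p)).hasFDerivAt.comp 0 h1
  refine (h2.sub (h3.smul (hasFDerivAt_id (0 : CPModel H)))).congr_fderiv ?_
  ext1 w
  simp [affineLift]

theorem contDiff_affineField (p : ℙ ℂ H) (S : H →L[ℂ] H) {n : ℕ∞ω} :
    ContDiff ℝ n (affineField p S) := by
  have h1 : ContDiff ℝ n fun w => S (affineLift p w) :=
    (S.restrictScalars ℝ).contDiff.comp (contDiff_affineLift p)
  exact (((horCoord p).restrictScalars ℝ).contDiff.comp h1).sub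
    ((((innerSL ℂ (unitRep p)).restrictScalars ℝ).contDiff.comp h1).smul contDiff_id)

theorem affineField_zero (p : ℙ ℂ H) (S : H →L[ℂ] H) :
    affineField p S 0 = horCoord p (S (unitRep p)) := by
  simp [affineField, affineLift]

/-- Let `P` be the projection off `u = unitRep p`. Expanding `P S u = S u - ⟨u, S u⟩ u` inside the
derivatives produces terms in `⟨u, S u⟩ P T u` and `⟨u, T u⟩ P S u` which cancel in pairs, leaving
`P (T S - S T) u`. -/
theorem lieBracket_affineField_zero (p : ℙ ℂ H) (S T : H →L[ℂ] H) :
    VectorField.lieBracket ℝ (affineField p S) (affineField p T) 0 =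
      -affineField p (S * T - T * S) 0 := by
  rw [VectorField.lieBracket_eq]
  simp only [((hasFDerivAt_affineField_zero p S).restrictScalars ℝ).fderiv,
    ((hasFDerivAt_affineField_zero p T).restrictScalars ℝ).fderiv, affineField_zero]
  simp [horLift_horCoord, -Complex.coe_smul]
  abel

/-- Moves smoothness and brackets to the flat model space. The identity holds on the whole chart
domain. -/
theorem eventuallyEq_operatorField_mpullback (p : ℙ ℂ H) (S : H →L[ℂ] H) :
    operatorField S =ᶠ[𝓝 p]
      VectorField.mpullback 𝓘(ℝ, CPModel H) 𝓘(ℝ, CPModel H) (affineChart p) (affineField p S) := by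
  filter_upwards [(affineChart p).open_source.mem_nhds (mem_chart_source (CPModel H) p)] with x hx
  have hinv : (mfderiv 𝓘(ℝ, CPModel H) 𝓘(ℝ, CPModel H) (affineChart p) x).IsInvertible :=
    isInvertible_mfderiv_extChartAt (I := 𝓘(ℝ, CPModel H)) (x := p)
      (by simpa using! hx)
  -- It remains to see that the differential of the chart sends the field to `affineField`, which is
  -- checked on the unit representative of `x`.
  refine Eq.symm (hinv.inverse_apply_eq.2 ?_)
  have hv := unitRep_ne_zero x
  have hp : ⟪unitRep p, unitRep x⟫_ℂ ≠ 0 := by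
    rwa [← mem_source_affineChart_mk p hv, mk_unitRep]
  have h1 := mfderiv_affineChart_lineDeriv p p hv hp (S (unitRep x))
  rw [← operatorField_lineOr S p hv, lineOr_unitRep, affineMapDeriv_operator p S hp] at h1
  rw [← affineChart_lineOr p p hv, lineOr_unitRep] at h1
  exact h1.symm

theorem contMDiff_affineField (p : ℙ ℂ H) (S : H →L[ℂ] H) :
    ContMDiff 𝓘(ℝ, CPModel H) 𝓘(ℝ, CPModel H).tangent ∞
      (fun w => (⟨w, affineField p S w⟩ : TangentBundle 𝓘(ℝ, CPModel H) (CPModel H))) :=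
  contMDiff_vectorSpace_iff_contDiff.2 (contDiff_affineField p S)

theorem isSmoothField_operatorField (S : H →L[ℂ] H) : IsSmoothField (operatorField S) := by
  intro p
  have hp : p ∈ (affineChart p).source := mem_chart_source (CPModel H) p
  have hinv : (mfderiv 𝓘(ℝ, CPModel H) 𝓘(ℝ, CPModel H) (affineChart p) p).IsInvertible :=
    isInvertible_mfderiv_extChartAt (I := 𝓘(ℝ, CPModel H)) (x := p) (by simp)
  have h := ContMDiffAt.mpullback_vectorField_preimage (m := ∞) (n := ∞)
    ((contMDiff_affineField p S) (affineChart p p)) (contMDiffAt_affineChart p hp) hinv (by simp)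
  refine h.congr_of_eventuallyEq ?_
  filter_upwards [eventuallyEq_operatorField_mpullback p S] with x hx
  exact congrArg (fun v : TangentSpace 𝓘(ℝ, CPModel H) x =>
    (⟨x, v⟩ : TangentBundle 𝓘(ℝ, CPModel H) (ℙ ℂ H))) hx

theorem affineChart_self (p : ℙ ℂ H) : affineChart p p = 0 := by
  have h := affineChart_lineOr p p (unitRep_ne_zero p)
  rwa [lineOr_unitRep, affineMap, horCoord_unitRep, smul_zero] at h

theorem mlieBracket_eq_lieBracket {E : Type*} [NormedAddCommGroup E] [NormedSpace ℝ E]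
    {V W : (x : E) → TangentSpace 𝓘(ℝ, E) x} :
    VectorField.mlieBracket 𝓘(ℝ, E) V W = VectorField.lieBracket ℝ V W := by
  rw [← VectorField.mlieBracketWithin_univ, VectorField.mlieBracketWithin_eq_lieBracketWithin]
  exact VectorField.lieBracketWithin_univ

/-- The bracket is local and natural under pullback, so its value at `p` is read off at the origin
of the chart centred at `p`. -/
theorem fieldBracket_operatorField (S T : H →L[ℂ] H) :
    fieldBracket (operatorField S) (operatorField T) = -operatorField (S * T - T * S) := by
  funext p
  have hp : p ∈ (affineChart p).source := mem_chart_source (CPModel H) p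
  have h0 := affineChart_self p
  have h1 := (eventuallyEq_operatorField_mpullback p S).mlieBracket_vectorField_eq
    (eventuallyEq_operatorField_mpullback p T)
  have h2 := VectorField.mpullback_mlieBracket (n := ∞)
    (((contMDiff_affineField p S) (affineChart p p)).mdifferentiableAt (by simp))
    (((contMDiff_affineField p T) (affineChart p p)).mdifferentiableAt (by simp))
    (contMDiffAt_affineChart p hp)
    -- Over `ℝ`, naturality of the bracket requires the chart to be only twice continuously
    -- differentiable.
    (by rw [minSmoothness_of_isRCLikeNormedField]; exact WithTop.coe_le_coe.2 le_top)
  refine (h1.trans h2.symm).trans ?_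
  have h3 := (eventuallyEq_operatorField_mpullback p (S * T - T * S)).eq_of_nhds
  refine Eq.trans ?_ (congrArg Neg.neg h3.symm)
  refine Eq.trans ?_ (map_neg (mfderiv 𝓘(ℝ, CPModel H) 𝓘(ℝ, CPModel H) (affineChart p) p).inverse
    (affineField p (S * T - T * S) (affineChart p p)))
  refine congrArg (mfderiv 𝓘(ℝ, CPModel H) 𝓘(ℝ, CPModel H) (affineChart p) p).inverse ?_
  rw [h0]
  exact (congrFun mlieBracket_eq_lieBracket 0).trans (lieBracket_affineField_zero p S T)

/-! ### Integral curves -/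

theorem hasMFDerivAt_lineOr_comp (p₀ : ℙ ℂ H) {c : ℝ → H} {c' : H} {t : ℝ}
    (hc : HasDerivAt c c' t) (h0 : c t ≠ 0) :
    HasMFDerivAt 𝓘(ℝ, ℝ) 𝓘(ℝ, CPModel H) (fun s => lineOr p₀ (c s)) t
      ((1 : ℝ →L[ℝ] ℝ).smulRight (lineDeriv (c t) (lineOr p₀ (c t)) c')) := by
  have h := (hasMFDerivAt_lineOr p₀ h0).comp t hc.hasFDerivAt.hasMFDerivAt
  exact h.congr_mfderiv (ContinuousLinearMap.ext fun r : ℝ =>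
    map_smul (lineDeriv (c t) (lineOr p₀ (c t))) r c')

theorem slExp_unitRep_ne_zero (S : slAlgebra H) (p : ℙ ℂ H) :
    NormedSpace.exp (S : H →L[ℂ] H) (unitRep p) ≠ 0 :=
  (slExp S).1.map_ne_zero_iff.2 (unitRep_ne_zero p)

theorem hasDerivAt_exp_smul_apply (S : H →L[ℂ] H) (v : H) (t : ℝ) :
    HasDerivAt (fun s : ℝ => NormedSpace.exp (s • S) v) (S (NormedSpace.exp (t • S) v)) t := by
  have h := hasDerivAt_exp_smul_const' (𝕂 := ℝ) S t
  exact ((ContinuousLinearMap.apply ℂ H v).restrictScalars ℝ).hasFDerivAt.comp_hasDerivAt t h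

/-- The curve `exp(tS) u` solves `c' = S c` in `H` and never meets `0`, and `operatorField_lineOr`
projects this equation. -/
theorem isMIntegralCurve_slExp_smul (S : slAlgebra H) (p : ℙ ℂ H) :
    IsMIntegralCurve (I := 𝓘(ℝ, CPModel H)) (fun t : ℝ => slExp (t • S) • p)
      (operatorField (S : H →L[ℂ] H)) := by
  intro t
  have he : (fun t : ℝ => slExp (t • S) • p) =
      fun t : ℝ => lineOr p (NormedSpace.exp (t • (S : H →L[ℂ] H)) (unitRep p)) :=
    funext fun t => smul_eq_lineOr _ p p
  have h0 : NormedSpace.exp (t • (S : H →L[ℂ] H)) (unitRep p) ≠ 0 :=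
    slExp_unitRep_ne_zero (t • S) p
  have h := hasMFDerivAt_lineOr_comp p (hasDerivAt_exp_smul_apply (S : H →L[ℂ] H) (unitRep p) t) h0
  rw [← operatorField_lineOr _ _ h0] at h
  rw [he]
  exact h

theorem fieldX_eq_operatorField (A : suAlgebra H) :
    fieldX A = operatorField (A : H →L[ℂ] H) := by
  funext p
  have h := (isMIntegralCurve_slExp_smul (suToSl A) p 0).mfderiv
  have h1 := DFunLike.congr_fun h (1 : ℝ)
  refine Eq.trans h1 ?_
  -- The velocity at time `0` is based at `exp(0) · p`. All tangent spaces unfold to the model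
  -- space, so the value can be transported along this equality.
  have h2 : slExp ((0 : ℝ) • suToSl A) • p = p := by
    rw [smul_eq_lineOr _ p p, slExp_apply]
    simp [lineOr_unitRep]
  refine Eq.trans (one_smul ℝ _) ?_
  exact congrArg (fun q => (horCoord q (A.1 (unitRep q)) : CPModel H)) h2

theorem isMIntegralCurve_suExp_smul (A : suAlgebra H) (p : ℙ ℂ H) :
    IsMIntegralCurve (I := 𝓘(ℝ, CPModel H)) (fun t : ℝ => suExp (t • A) • p) (fieldX A) := by
  rw [fieldX_eq_operatorField]
  exact isMIntegralCurve_slExp_smul (suToSl A) p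

theorem complexStructure_operatorField (S : H →L[ℂ] H) (p : ℙ ℂ H) :
    complexStructure p (operatorField S p) = operatorField (Complex.I • S) p :=
  (map_smul (horCoord p) Complex.I (S (unitRep p))).symm

theorem fieldY_eq_operatorField (A : suAlgebra H) :
    fieldY A = operatorField (Complex.I • (A : H →L[ℂ] H)) := by
  funext p
  rw [fieldY, fieldX_eq_operatorField, complexStructure_operatorField]

/-! ### Expectation values -/

/-- The representative `rep` is an arbitrary choice without continuity. The affine lift replaces it
by one that depends smoothly on the line. -/
theorem expectation_eq_affineChart (a : H →L[ℂ] H) (p : ℙ ℂ H) {x : ℙ ℂ H}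
    (hx : x ∈ (affineChart p).source) :
    expectation a x = (⟪affineLift p (affineChart p x), a (affineLift p (affineChart p x))⟫_ℂ /
      ⟪affineLift p (affineChart p x), affineLift p (affineChart p x)⟫_ℂ).re := by
  conv_lhs => rw [← mk_affineLift_affineChart p hx]
  rw [expectation_mk]

theorem contMDiff_expectation (a : H →L[ℂ] H) :
    ContMDiff 𝓘(ℝ, CPModel H) 𝓘(ℝ, ℝ) ∞ (expectation a) := by
  intro p
  have hp : p ∈ (affineChart p).source := mem_chart_source (CPModel H) p
  have h1 := (contDiffAt_rayleigh a (affineLift_ne_zero p (affineChart p p)) (n := ∞)).comp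
    (affineChart p p) (contDiff_affineLift p).contDiffAt
  refine (h1.contMDiffAt.comp p (contMDiffAt_affineChart p hp)).congr_of_eventuallyEq ?_
  filter_upwards [(affineChart p).open_source.mem_nhds hp] with x hx
  exact expectation_eq_affineChart a p hx

/-- Along `u + t h` with `h ⊥ u` the denominator is stationary with value `1`. Self-adjointness
makes the two terms from the numerator complex conjugates, whence the factor `2`. -/
theorem fderiv_rayleigh_apply {a : H →L[ℂ] H} (ha : IsSelfAdjoint a) {u h : H}
    (hu : ‖u‖ = 1) (huh : ⟪u, h⟫_ℂ = 0) :
    fderiv ℝ (fun v : H => (⟪v, a v⟫_ℂ / ⟪v, v⟫_ℂ).re) u h = 2 * (⟪h, a u⟫_ℂ).re := by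
  have huu : ⟪u, u⟫_ℂ = 1 := by rw [inner_self_eq_norm_sq_to_K, hu]; simp
  have hhu : ⟪h, u⟫_ℂ = 0 := by rw [← inner_conj_symm, huh, map_zero]
  have hc : HasDerivAt (fun t : ℝ => u + t • h) h 0 := by
    simpa using ((hasDerivAt_id (0 : ℝ)).smul_const h).const_add u
  have hac : HasDerivAt (fun t : ℝ => a (u + t • h)) (a h) 0 :=
    (a.restrictScalars ℝ).hasFDerivAt.comp_hasDerivAt 0 hc
  have h1 := hc.inner ℂ hac
  have h2 := hc.inner ℂ hc
  have h3 := Complex.reCLM.hasFDerivAt.comp_hasDerivAt 0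
    (h1.div h2 (by rw [zero_smul, add_zero, huu]; exact one_ne_zero))
  have hu0 : u ≠ 0 := norm_ne_zero_iff.1 (by rw [hu]; exact one_ne_zero)
  have hd : HasFDerivAt (fun v : H => (⟪v, a v⟫_ℂ / ⟪v, v⟫_ℂ).re)
      (fderiv ℝ (fun v : H => (⟪v, a v⟫_ℂ / ⟪v, v⟫_ℂ).re) u) (u + (0 : ℝ) • h) := by
    rw [zero_smul, add_zero]
    exact ((contDiffAt_rayleigh a hu0 (n := 1)).differentiableAt one_ne_zero).hasFDerivAt
  have h4 := hd.comp_hasDerivAt 0 hc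
  have h5 := h4.unique h3
  have h6 : ⟪u, a h⟫_ℂ = (starRingEnd ℂ) ⟪h, a u⟫_ℂ := by
    rw [inner_conj_symm, ← ContinuousLinearMap.adjoint_inner_left,
      ← ContinuousLinearMap.star_eq_adjoint, ha.star_eq]
  rw [h5, zero_smul, add_zero, huu, huh, hhu, h6]
  simp only [add_zero, mul_zero, sub_zero, mul_one, one_pow, div_one, Complex.reCLM_apply,
    Complex.add_re, Complex.conj_re]
  ring

theorem lineDeriv_horLift (p : ℙ ℂ H) (w : CPModel H) :
    lineDeriv (unitRep p) p (horLift p w) = w := by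
  change (⟪unitRep p, unitRep p⟫_ℂ)⁻¹ • horCoord p (horLift p w) = w
  rw [inner_unitRep_self, inv_one, one_smul, horCoord_horLift]

/-- The chain rule for `expectation a ∘ lineOr p`, evaluated on `horLift p w`, which is a horizontal
preimage of `w`. -/
theorem mfderiv_expectation {a : H →L[ℂ] H} (ha : IsSelfAdjoint a) (p : ℙ ℂ H)
    (w : TangentSpace 𝓘(ℝ, CPModel H) p) :
    mfderiv 𝓘(ℝ, CPModel H) 𝓘(ℝ, ℝ) (expectation a) p w =
      2 * (⟪horLift p w, a (unitRep p)⟫_ℂ).re := by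
  have hv := unitRep_ne_zero p
  have h1 := hasMFDerivAt_lineOr p hv
  have hp := lineOr_unitRep p p
  have h2 : HasMFDerivAt 𝓘(ℝ, CPModel H) 𝓘(ℝ, ℝ) (expectation a) (lineOr p (unitRep p))
      (mfderiv 𝓘(ℝ, CPModel H) 𝓘(ℝ, ℝ) (expectation a) (lineOr p (unitRep p))) :=
    ((contMDiff_expectation a _).mdifferentiableAt (by simp)).hasMFDerivAt
  have h3 := h2.comp _ h1
  have h4 : HasMFDerivAt 𝓘(ℝ, H) 𝓘(ℝ, ℝ) (expectation a ∘ lineOr p) (unitRep p)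
      (fderiv ℝ (fun v : H => (⟪v, a v⟫_ℂ / ⟪v, v⟫_ℂ).re) (unitRep p) : H →L[ℝ] ℝ) := by
    have he : expectation a ∘ lineOr p =ᶠ[𝓝 (unitRep p)]
        fun v : H => (⟪v, a v⟫_ℂ / ⟪v, v⟫_ℂ).re := by
      filter_upwards [isOpen_ne.mem_nhds hv] with u hu
      rw [Function.comp_apply, lineOr_of_ne_zero p hu, expectation_mk]
    have hd := ((contDiffAt_rayleigh a hv (n := 1)).differentiableAt one_ne_zero).hasFDerivAt
    have hd' := hd.congr_of_eventuallyEq he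
    exact hd'.hasMFDerivAt
  have h5 := DFunLike.congr_fun (hasMFDerivAt_unique h3 h4) (horLift p w)
  rw [hp] at h5
  have h6 := fderiv_rayleigh_apply ha (norm_unitRep p) (inner_unitRep_horLift p w)
  refine Eq.trans ?_ (h5.trans h6)
  exact congrArg (mfderiv 𝓘(ℝ, CPModel H) 𝓘(ℝ, ℝ) (expectation a) p) (lineDeriv_horLift p w).symm

/-- Since `horLift p w` is orthogonal to `unitRep p`, both the correction term of the metric and the
vertical part of `S (unitRep p)` drop out. -/
theorem fubiniStudyMetric_operatorField (p : ℙ ℂ H) (w : TangentSpace 𝓘(ℝ, CPModel H) p)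
    (S : H →L[ℂ] H) :
    fubiniStudyMetric p w (operatorField S p) = (⟪horLift p w, S (unitRep p)⟫_ℂ).re := by
  have h : ⟪horLift p w, unitRep p⟫_ℂ = 0 := by
    rw [← inner_conj_symm]
    exact (congrArg _ (inner_unitRep_horLift p w)).trans (map_zero _)
  change (fubiniStudyForm (unitRep p) (horLift p w) (horLift p (horCoord p (S (unitRep p))))).re = _
  rw [horLift_horCoord, fubiniStudyForm, inner_unitRep_self, inner_sub_right, inner_smul_right, h]
  simp

theorem isSelfAdjoint_I_smul (A : suAlgebra H) : IsSelfAdjoint (Complex.I • (A : H →L[ℂ] H)) := by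
  rw [IsSelfAdjoint, star_smul, A.2.1]
  simp

/-- Both sides equal `Re ⟨horLift p v, iA u⟩`; the factor `1/2` in `f_A` absorbs the `2` of the
Rayleigh derivative. -/
theorem isGradientField_fieldY (A : suAlgebra H) :
    IsGradientField
      (fun p => (1 / 2 : ℝ) * expectation (Complex.I • (A : H →L[ℂ] H)) p) (fieldY A) := by
  have hs := contMDiff_expectation (Complex.I • (A : H →L[ℂ] H))
  refine ⟨contMDiff_const.mul hs, fun p v => ?_⟩
  rw [fieldY_eq_operatorField, fubiniStudyMetric_operatorField]
  have h := ((hs p).mdifferentiableAt (by simp)).hasMFDerivAt.const_smul (1 / 2 : ℝ)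
  have h2 := DFunLike.congr_fun h.mfderiv v
  refine Eq.trans h2 ?_
  refine Eq.trans (congrArg (fun r : ℝ => (1 / 2 : ℝ) * r)
    (mfderiv_expectation (isSelfAdjoint_I_smul A) p v)) ?_
  change (1 / 2 : ℝ) * (2 * _) = _
  rw [← mul_assoc, one_div, inv_mul_cancel₀ two_ne_zero, one_mul]

/-- By definition `ω(·, X_A) = g(·, J X_A) = g(·, Y_A)`, so this is literally the gradient
statement. -/
theorem isHamiltonianField_fieldX (A : suAlgebra H) :
    IsHamiltonianField
      (fun p => (1 / 2 : ℝ) * expectation (Complex.I • (A : H →L[ℂ] H)) p) (fieldX A) :=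
  isGradientField_fieldY A

/-! ### The realization of `𝔰𝔩(H)` -/

variable (H) in
/-- The vector fields generated by traceless operators, as a linear map. -/
def slField : slAlgebra H →ₗ[ℝ] CPVectorField H where
  toFun S := operatorField (S : H →L[ℂ] H)
  map_add' S T := funext fun p => map_add (horCoord p) (S.1 (unitRep p)) (T.1 (unitRep p))
  map_smul' c S := funext fun p =>
    map_smul ((horCoord p).restrictScalars ℝ) c (S.1 (unitRep p))

theorem slField_injective : Function.Injective (slField H) := by
  rw [injective_iff_map_eq_zero]
  intro S hS
  -- A vanishing field means that `S` preserves every line, so each nonzero vector is an eigenvector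
  -- and `S` is a scalar `c`.
  have h1 : ∀ v : H, ¬ LinearIndependent ℂ ![v, (S : H →L[ℂ] H).toLinearMap v] := by
    intro v hv
    have h0 : v ≠ 0 := hv.ne_zero 0
    let p := Projectivization.mk ℂ v h0
    have h2 : horCoord p (S.1 (unitRep p)) = 0 := congrFun hS p
    have h3 := horLift_horCoord p (S.1 (unitRep p))
    rw [h2, map_zero, eq_comm, sub_eq_zero] at h3
    have h4 : v = _ • unitRep p := eq_smul_unitRep_proj (⟨v, h0⟩ : nonzeroVectors H)
    have h5 : S.1 v = ⟪unitRep p, S.1 (unitRep p)⟫_ℂ • v := by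
      rw [h4, map_smul, h3, smul_comm, inner_smul_right, inner_unitRep_self, mul_one]
    have h6 := (LinearIndependent.pair_iff.1 hv) ⟪unitRep p, S.1 (unitRep p)⟫_ℂ (-1) (by
      rw [← h5]
      simp)
    simp at h6
  obtain ⟨c, hc⟩ := LinearMap.exists_eq_smul_id_of_forall_notLinearIndependent h1
  have ht : LinearMap.trace ℂ H (S : H →L[ℂ] H).toLinearMap = 0 := S.2
  rw [hc, map_smul, LinearMap.trace_one, smul_eq_mul, mul_eq_zero] at ht
  apply Subtype.ext
  ext v
  have hv : S.1 v = c • v := LinearMap.congr_fun hc v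
  -- The trace is `c · dim H`, so either `c = 0` or `H` is the zero space.
  rcases ht with rfl | h0
  · simpa using hv
  · have : Subsingleton H := Module.finrank_zero_iff.1 (Nat.cast_eq_zero.1 h0)
    exact Subsingleton.elim _ _

/-! ### The action of `SL(H)` -/

/-- The formula `(T, q) ↦ [T v]`, with `v` the affine lift of `q`, makes sense for every operator
`T` with `T v ≠ 0`. This is an open condition, and it holds for all invertible `T`. -/
theorem isSmoothAction_toPermHom :
    IsSmoothAction (MulAction.toPermHom (SpecialLinearGroup ℂ H) (ℙ ℂ H)) := by
  intro g p
  let L : (H →L[ℂ] H) × ℙ ℂ H → H := fun x => x.1 (affineLift p (affineChart p x.2))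
  let U₀ : Set ((H →L[ℂ] H) × ℙ ℂ H) := Prod.snd ⁻¹' (affineChart p).source
  have hU₀ : IsOpen U₀ := (affineChart p).open_source.preimage continuous_snd
  have happ : ContDiff ℝ ∞ fun x : (H →L[ℂ] H) × H => x.1 x.2 :=
    (isBoundedBilinearMap_apply (𝕜 := ℂ) (E := H) (F := H)).contDiff.restrict_scalars ℝ
  have hL : ContMDiffOn (𝓘(ℝ, H →L[ℂ] H).prod 𝓘(ℝ, CPModel H)) 𝓘(ℝ, H) ∞ L U₀ := by
    intro x hx
    have h1 : ContMDiffAt (𝓘(ℝ, H →L[ℂ] H).prod 𝓘(ℝ, CPModel H)) 𝓘(ℝ, H) ∞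
        (fun x : (H →L[ℂ] H) × ℙ ℂ H => affineLift p (affineChart p x.2)) x :=
      (contDiff_affineLift p).contMDiff.contMDiffAt.comp x
        ((contMDiffAt_affineChart p hx).comp x contMDiffAt_snd)
    have h2 : ContMDiffAt (𝓘(ℝ, H →L[ℂ] H).prod 𝓘(ℝ, CPModel H)) 𝓘(ℝ, H →L[ℂ] H) ∞
        (fun x : (H →L[ℂ] H) × ℙ ℂ H => x.1) x := contMDiffAt_fst
    exact (happ.contMDiff.contMDiffAt.comp x (h2.prodMk_space h1)).contMDiffWithinAt
  have hact : ∀ (h : SpecialLinearGroup ℂ H) (q : ℙ ℂ H), q ∈ (affineChart p).source →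
      lineOr p (L (slOperator h, q)) = h • q := by
    intro h q hq
    have h0 : h (affineLift p (affineChart p q)) ≠ 0 :=
      h.1.map_ne_zero_iff.2 (affineLift_ne_zero p _)
    conv_rhs => rw [← mk_affineLift_affineChart p hq]
    exact lineOr_of_ne_zero p h0
  refine ⟨U₀ ∩ L ⁻¹' {v | v ≠ 0}, hL.continuousOn.isOpen_inter_preimage hU₀ isOpen_ne,
    ⟨mem_chart_source (CPModel H) p, ?_⟩, lineOr p ∘ L, ?_, fun h q hq => hact h q hq.1⟩
  · exact g.1.map_ne_zero_iff.2 (affineLift_ne_zero p _)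
  · intro x hx
    exact (contMDiffAt_lineOr p hx.2).comp_contMDiffWithinAt x
      ((hL x hx.1).mono Set.inter_subset_left)

end

end QuantumGeometry

open QuantumGeometry

theorem mainTheorem1 {H : Type*} [NormedAddCommGroup H] [InnerProductSpace ℂ H]
    [FiniteDimensional ℂ H] :
    -- the projective space is a compact manifold
    CompactSpace (ℙ ℂ H) ∧
    -- `X_A` generates the action of `SU(H)`; `X_A` and `Y_A = J(X_A)` are the Hamiltonian and the
    -- gradient vector field of the same smooth function
    (∀ A : suAlgebra H,
      (∀ p : ℙ ℂ H, IsMIntegralCurve (I := 𝓘(ℝ, CPModel H))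
        (fun t : ℝ => suExp (t • A) • p) (fieldX A)) ∧
      IsSmoothField (fieldX A) ∧ IsSmoothField (fieldY A) ∧
      IsHamiltonianField
        (fun p => (1 / 2 : ℝ) * expectation (Complex.I • (A : H →L[ℂ] H)) p) (fieldX A) ∧
      IsGradientField
        (fun p => (1 / 2 : ℝ) * expectation (Complex.I • (A : H →L[ℂ] H)) p) (fieldY A)) ∧
    -- the commutation relations
    (∀ A B : suAlgebra H,
      fieldBracket (fieldX A) (fieldX B) = -fieldX ⁅A, B⁆ ∧
      fieldBracket (fieldX A) (fieldY B) = -fieldY ⁅A, B⁆ ∧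
      fieldBracket (fieldY A) (fieldY B) = fieldX ⁅A, B⁆) ∧
    -- the realization of `𝔰𝔩(H)` by these vector fields
    ∃ ζ : slAlgebra H →ₗ[ℝ] CPVectorField H,
      Function.Injective ζ ∧
      (∀ A : suAlgebra H, ζ (suToSl A) = fieldX A ∧ ζ (Complex.I • suToSl A) = fieldY A) ∧
      (∀ S T : slAlgebra H, fieldBracket (ζ S) (ζ T) = -ζ ⁅S, T⁆) ∧
      -- it integrates to an action of `SL(H)`
      ∃ Φ : SpecialLinearGroup ℂ H →* Equiv.Perm (ℙ ℂ H),
        IsSmoothAction Φ ∧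
        ∀ (S : slAlgebra H) (p : ℙ ℂ H), IsMIntegralCurve (I := 𝓘(ℝ, CPModel H))
          (fun t : ℝ => Φ (slExp (t • S)) p) (ζ S) := by
  refine ⟨inferInstance, fun A => ⟨isMIntegralCurve_suExp_smul A, ?_, ?_,
    isHamiltonianField_fieldX A, isGradientField_fieldY A⟩, fun A B => ⟨?_, ?_, ?_⟩,
    slField H, slField_injective, fun A => ⟨(fieldX_eq_operatorField A).symm,
      (fieldY_eq_operatorField A).symm⟩, fun S T => fieldBracket_operatorField S.1 T.1,
    MulAction.toPermHom _ _, isSmoothAction_toPermHom, isMIntegralCurve_slExp_smul⟩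
  · rw [fieldX_eq_operatorField]
    exact isSmoothField_operatorField _
  · rw [fieldY_eq_operatorField]
    exact isSmoothField_operatorField _
  · rw [fieldX_eq_operatorField, fieldX_eq_operatorField, fieldX_eq_operatorField,
      fieldBracket_operatorField]
    rfl
  · rw [fieldX_eq_operatorField, fieldY_eq_operatorField, fieldY_eq_operatorField,
      fieldBracket_operatorField, LieSubalgebra.coe_bracket, Ring.lie_def, smul_sub,
      mul_smul_comm, smul_mul_assoc]
  · rw [fieldX_eq_operatorField, fieldY_eq_operatorField, fieldY_eq_operatorField,
      fieldBracket_operatorField, LieSubalgebra.coe_bracket, Ring.lie_def]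
    funext p
    change -horCoord p _ = horCoord p _
    rw [← map_neg]
    congr 1
    -- The two factors `i` multiply to `-1`, which cancels the minus sign of the bracket formula.
    simp [smul_smul]
    abel
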